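/- Let $\mathit{Atm}_0$ be a finite set of atomic propositions and $\mathit{Val}$ a finite set of output values. The language $\mathcal L$ consists of the formulas $$\varphi ::= p \mid \mathsf t(x) \mid \neg\varphi \mid \varphi_1\wedge\varphi_2 \mid \Box_{\mathtt I}\varphi \mid \Box_{\mathtt F}\varphi \qquad (p\in \mathit{Atm}_0,\ x\in \mathit{Val}),$$ where $\mathsf t(x)$ is the decision atom of $x$. A multi-classifier model (MCM) is a pair $\Gamma=(S,\Phi)$ with $S\subseteq 2^{\mathit{Atm}_0}$ and $\Phi\subseteq \mathit{Val}^S$. For $s\in S$ and $f\in\Phi$, satisfaction is defined by: $(\Gamma,s,f)\models p$ iff $p\in s$; $(\Gamma,s,f)\models \mathsf t(x)$ iff $f(s)=x$; $\neg$ and $\wedge$ are interpreted as usual; $(\Gamma,s,f)\models\Box_{\mathtt I}\varphi$ iff $(\Gamma,s',f)\models\varphi$ for all $s'\in S$; $(\Gamma,s,f)\models\Box_{\mathtt F}\varphi$ iff $(\Gamma,s,f')\models\varphi$ for all $f'\in\Phi$. A formula $\varphi$ is satisfiable relative to the class $\mathbf{MCM}$ of all multi-classifier models if $(\Gamma,s,f)\models\varphi$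 for some MCM $\Gamma=(S,\Phi)$, some $s\in S$ and some $f\in\Phi$. Then, for fixed finite $\mathit{Atm}_0$ and $\mathit{Val}$, checking satisfiability of $\mathcal L$-formulas relative to $\mathbf{MCM}$ can be done in polynomial time: writing formulas in prefix notation as words over the finite alphabet $\mathit{Atm}_0\cup\{\mathsf t(x): x\in\mathit{Val}\}\cup\{\neg,\wedge,\Box_{\mathtt I},\Box_{\mathtt F}\}$, there are a deterministic Turing machine and a polynomial $P$ such that, on every word $w$ over this alphabet, the machine halts after at most $P(|w|)$ steps and correctly outputs whether $w$ is a satisfiable formula. -/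

import Mathlib

namespace PLC

/-- Formulas of the modal language over the input atoms `Atm` and the output values `Val`. -/
inductive Formula (Atm Val : Type) : Type
  /-- an atomic proposition `p` (an input variable) -/
  | atom (p : Atm) : Formula Atm Val
  /-- the decision atom "the output is `x`" -/
  | dec (x : Val) : Formula Atm Val
  | neg (φ : Formula Atm Val) : Formula Atm Val
  | conj (φ ψ : Formula Atm Val) : Formula Atm Val
  /-- necessity over the input instances, for the current classifier -/
  | boxI (φ : Formula Atm Val) : Formula Atm Val
  /-- necessity over the classifiers, for the current input instance -/
  | boxF (φ : Formula Atm Val) : Formula Atm Val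

/-- A multi-classifier model: a set `S` of input instances (subsets of `Atm`) and a set `Φ` of
functions from `S` to `Val`. -/
structure MCM (Atm Val : Type) where
  S : Set (Set Atm)
  Φ : Set (S → Val)

variable {Atm Val : Type}

/-- The satisfaction relation of a multi-classifier model at an instance `s` and a function `f`
(meant for `f ∈ Γ.Φ`). -/
def Sat (Γ : MCM Atm Val) : Γ.S → (Γ.S → Val) → Formula Atm Val → Prop
  | s, _, .atom p => p ∈ s.1
  | s, f, .dec x => f s = x
  | s, f, .neg φ => ¬ Sat Γ s f φ
  | s, f, .conj φ ψ => Sat Γ s f φ ∧ Sat Γ s f ψ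
  | _, f, .boxI φ => ∀ s' : Γ.S, Sat Γ s' f φ
  | s, _, .boxF φ => ∀ f' ∈ Γ.Φ, Sat Γ s f' φ

/-- Satisfiability relative to the class of all multi-classifier models: truth at some pointed
multi-classifier model. -/
def Satisfiable (φ : Formula Atm Val) : Prop :=
  ∃ (Γ : MCM Atm Val) (s : Γ.S) (f : Γ.S → Val), f ∈ Γ.Φ ∧ Sat Γ s f φ

/-- The symbols in which formulas are written: one for each atom and one for each operator. The
alphabet is finite when `Atm` and `Val` are. -/
inductive Symbol (Atm Val : Type) : Type
  | atom (p : Atm) : Symbol Atm Val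
  | dec (x : Val) : Symbol Atm Val
  | neg : Symbol Atm Val
  | conj : Symbol Atm Val
  | boxI : Symbol Atm Val
  | boxF : Symbol Atm Val

/-- A formula written as a word in prefix (Polish) notation. The length of the word is the number
of occurrences of atoms and operators in the formula. -/
def Formula.encode : Formula Atm Val → List (Symbol Atm Val)
  | .atom p => [.atom p]
  | .dec x => [.dec x]
  | .neg φ => .neg :: φ.encode
  | .conj φ ψ => .conj :: (φ.encode ++ ψ.encode)
  | .boxI φ => .boxI :: φ.encode
  | .boxF φ => .boxF :: φ.encode

theorem Formula.encode_append_inj (φ : Formula Atm Val) :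
    ∀ (ψ : Formula Atm Val) (u v : List (Symbol Atm Val)),
      φ.encode ++ u = ψ.encode ++ v → φ = ψ ∧ u = v := by
  induction φ with
  | atom p => intro ψ u v h; cases ψ <;> simp_all [Formula.encode]
  | dec x => intro ψ u v h; cases ψ <;> simp_all [Formula.encode]
  | neg φ ih =>
    intro ψ u v h
    cases ψ <;> simp [Formula.encode] at h
    obtain ⟨rfl, rfl⟩ := ih _ _ _ h
    exact ⟨rfl, rfl⟩
  | conj φ₁ φ₂ ih₁ ih₂ =>
    intro ψ u v h
    cases ψ <;> simp [Formula.encode] at h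
    obtain ⟨rfl, h'⟩ := ih₁ _ _ _ h
    obtain ⟨rfl, rfl⟩ := ih₂ _ _ _ h'
    exact ⟨rfl, rfl⟩
  | boxI φ ih =>
    intro ψ u v h
    cases ψ <;> simp [Formula.encode] at h
    obtain ⟨rfl, rfl⟩ := ih _ _ _ h
    exact ⟨rfl, rfl⟩
  | boxF φ ih =>
    intro ψ u v h
    cases ψ <;> simp [Formula.encode] at h
    obtain ⟨rfl, rfl⟩ := ih _ _ _ h
    exact ⟨rfl, rfl⟩

/-- Unique readability. -/
theorem Formula.encode_injective :
    Function.Injective (Formula.encode : Formula Atm Val → List (Symbol Atm Val)) :=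
  fun φ ψ h => (φ.encode_append_inj ψ [] [] (by simpa using h)).1

/-- The satisfiability problem as a language: the words that are (well-formed and) satisfiable
formulas. -/
def satLanguage (Atm Val : Type) : Language (Symbol Atm Val) :=
  {w | ∃ φ : Formula Atm Val, Satisfiable φ ∧ φ.encode = w}

theorem encode_mem_satLanguage (φ : Formula Atm Val) :
    φ.encode ∈ satLanguage Atm Val ↔ Satisfiable φ :=
  ⟨fun ⟨_, h, e⟩ => Formula.encode_injective e ▸ h, fun h => ⟨φ, h, rfl⟩⟩

/-- A language is decidable in polynomial time: some multi-stack Turing machine, on every word `w`,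
halts with the truth value of `w ∈ L` as its output, after a number of steps that is at most a
fixed polynomial in the length of `w`. Finiteness of the alphabets of all the stacks is spelt out,
since the type of the machines only records it for the input stack. -/
def DecidableInPolyTime {A : Type} (L : Language A) : Prop :=
  ∃ χ : List A → Bool, (∀ w, χ w = true ↔ w ∈ L) ∧
    ∃ M : Turing.TM2ComputableInPolyTime (id : List A → List A) Computability.encodeBool χ,
      ∀ k, Finite (M.tm.Γ k)

end PLC

namespace PLC

/-! ### The truth set of a formula, an element of a finite algebra -/

/-- Pointed multi-classifier models. -/
abbrev PointedMCM (Atm Val : Type) : Type := Σ Γ : MCM Atm Val, Γ.S × Γ.Φ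

instance [Finite Atm] [Finite Val] : Finite (MCM Atm Val) :=
  Finite.of_injective (β := Σ S : Set (Set Atm), Set (S → Val)) (fun Γ => ⟨Γ.S, Γ.Φ⟩) <| by
    rintro ⟨S, Φ⟩ ⟨S', Φ'⟩ h
    cases h
    rfl

instance [Finite Atm] [Finite Val] : Finite (Symbol Atm Val) :=
  Finite.of_surjective (α := (Atm ⊕ Val) ⊕ Fin 4)
    (Sum.elim (Sum.elim .atom .dec) ![.neg, .conj, .boxI, .boxF]) <| by
    rintro (p | x | _ | _ | _ | _)
    exacts [⟨.inl (.inl p), rfl⟩, ⟨.inl (.inr x), rfl⟩, ⟨.inr 0, rfl⟩, ⟨.inr 1, rfl⟩,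
      ⟨.inr 2, rfl⟩, ⟨.inr 3, rfl⟩]

/-- The set of pointed models at which a formula is true. -/
def Formula.truthSet (φ : Formula Atm Val) : Set (PointedMCM Atm Val) :=
  {x | Sat x.1 x.2.1 x.2.2 φ}

theorem satisfiable_iff_truthSet_nonempty (φ : Formula Atm Val) :
    Satisfiable φ ↔ φ.truthSet.Nonempty :=
  ⟨fun ⟨Γ, s, f, hf, h⟩ => ⟨⟨Γ, s, f, hf⟩, h⟩, fun ⟨⟨Γ, s, f⟩, h⟩ => ⟨Γ, s, f, f.2, h⟩⟩

/-- The truth set of `□_I φ`, in terms of that of `φ`. -/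
def boxISet (v : Set (PointedMCM Atm Val)) : Set (PointedMCM Atm Val) :=
  {x | ∀ s : x.1.S, ⟨x.1, s, x.2.2⟩ ∈ v}

/-- The truth set of `□_F φ`, in terms of that of `φ`. -/
def boxFSet (v : Set (PointedMCM Atm Val)) : Set (PointedMCM Atm Val) :=
  {x | ∀ f : x.1.Φ, ⟨x.1, x.2.1, f⟩ ∈ v}

theorem Formula.truthSet_neg (φ : Formula Atm Val) : (neg φ).truthSet = φ.truthSetᶜ := rfl

theorem Formula.truthSet_conj (φ ψ : Formula Atm Val) :
    (conj φ ψ).truthSet = φ.truthSet ∩ ψ.truthSet := rfl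

theorem Formula.truthSet_boxI (φ : Formula Atm Val) :
    (boxI φ).truthSet = boxISet φ.truthSet := rfl

theorem Formula.truthSet_boxF (φ : Formula Atm Val) :
    (boxF φ).truthSet = boxFSet φ.truthSet := by
  ext ⟨Γ, s, f⟩
  simp [truthSet, boxFSet, Sat]

/-! ### Evaluation of words with a stack of truth sets -/

/-- The entries of the evaluation stack: truth sets, and `none` for an error. -/
abbrev StackVal (Atm Val : Type) : Type := Option (Set (PointedMCM Atm Val))

/-- The number of arguments of a symbol. -/
def Symbol.arity : Symbol Atm Val → ℕ
  | .atom _ | .dec _ => 0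
  | .neg | .boxI | .boxF => 1
  | .conj => 2

/-- The operation of a symbol on truth sets; missing arguments give an error. -/
def Symbol.apply : Symbol Atm Val → StackVal Atm Val → StackVal Atm Val → StackVal Atm Val
  | .atom p, _, _ => some (Formula.atom p).truthSet
  | .dec x, _, _ => some (Formula.dec x).truthSet
  | .neg, a, _ => a.map compl
  | .boxI, a, _ => a.map boxISet
  | .boxF, a, _ => a.map boxFSet
  | .conj, a, b => a.bind fun u => b.map fun v => u ∩ v

/-- Replace the arguments of a symbol on top of the stack by its value. -/
def Symbol.reduce (c : Symbol Atm Val) (l : List (StackVal Atm Val)) : List (StackVal Atm Val) :=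
  c.apply l.head?.join l.tail.head?.join :: l.drop c.arity

/-- The stack that results from reading a word from right to left. -/
def evalWord (w : List (Symbol Atm Val)) : List (StackVal Atm Val) := w.foldr Symbol.reduce []

@[simp] theorem evalWord_nil : evalWord ([] : List (Symbol Atm Val)) = [] := rfl

@[simp] theorem evalWord_cons (c : Symbol Atm Val) (w : List (Symbol Atm Val)) :
    evalWord (c :: w) = c.reduce (evalWord w) := rfl

theorem evalWord_encode_append (φ : Formula Atm Val) :
    ∀ w, evalWord (φ.encode ++ w) = some φ.truthSet :: evalWord w := by
  induction φ with
  | atom p => intro w; rfl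
  | dec x => intro w; rfl
  | neg φ ih => intro w; simp [Formula.encode, ih, Symbol.reduce, Symbol.apply, Symbol.arity,
      Formula.truthSet_neg]
  | conj φ ψ ih₁ ih₂ => intro w; simp [Formula.encode, ih₁, ih₂, Symbol.reduce, Symbol.apply,
      Symbol.arity, Formula.truthSet_conj]
  | boxI φ ih => intro w; simp [Formula.encode, ih, Symbol.reduce, Symbol.apply, Symbol.arity,
      Formula.truthSet_boxI]
  | boxF φ ih => intro w; simp [Formula.encode, ih, Symbol.reduce, Symbol.apply, Symbol.arity,
      Formula.truthSet_boxF]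

/-- A word that evaluates without error is a concatenation of formulas. -/
theorem exists_formulas_of_evalWord (w : List (Symbol Atm Val)) (h : none ∉ evalWord w) :
    ∃ l : List (Formula Atm Val),
      w = l.flatMap Formula.encode ∧ evalWord w = l.map fun φ => some φ.truthSet := by
  induction w with
  | nil => exact ⟨[], rfl, rfl⟩
  | cons c w ih =>
    have key : none ∉ evalWord w := by
      rw [evalWord_cons] at h
      clear ih
      generalize evalWord w = l at h ⊢
      rcases c with p | x | _ | _ | _ | _ <;> rcases l with _ | ⟨_ | u, _ | ⟨_ | v, l⟩⟩ <;>
        simp_all [Symbol.reduce, Symbol.apply, Symbol.arity]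
    obtain ⟨l, rfl, hl⟩ := ih key
    suffices ∃ l' : List (Formula Atm Val),
        c :: l.flatMap Formula.encode = l'.flatMap Formula.encode by
      obtain ⟨l', h'⟩ := this
      refine ⟨l', h', ?_⟩
      rw [h']
      clear h h'
      induction l' with
      | nil => rfl
      | cons φ l' ih => rw [List.flatMap_cons, evalWord_encode_append, ih]; rfl
    rw [evalWord_cons, hl] at h
    rcases c with p | x | _ | _ | _ | _
    · exact ⟨.atom p :: l, rfl⟩
    · exact ⟨.dec x :: l, rfl⟩
    · rcases l with _ | ⟨φ, l⟩
      · simp [Symbol.reduce, Symbol.apply] at h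
      · exact ⟨.neg φ :: l, rfl⟩
    · rcases l with _ | ⟨φ, _ | ⟨ψ, l⟩⟩
      · simp [Symbol.reduce, Symbol.apply] at h
      · simp [Symbol.reduce, Symbol.apply] at h
      · exact ⟨.conj φ ψ :: l, by simp [Formula.encode]⟩
    · rcases l with _ | ⟨φ, l⟩
      · simp [Symbol.reduce, Symbol.apply] at h
      · exact ⟨.boxI φ :: l, rfl⟩
    · rcases l with _ | ⟨φ, l⟩
      · simp [Symbol.reduce, Symbol.apply] at h
      · exact ⟨.boxF φ :: l, rfl⟩

theorem mem_satLanguage_iff_evalWord (w : List (Symbol Atm Val)) :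
    w ∈ satLanguage Atm Val ↔
      ∃ v : Set (PointedMCM Atm Val), evalWord w = [some v] ∧ v.Nonempty := by
  constructor
  · rintro ⟨φ, hφ, rfl⟩
    exact ⟨φ.truthSet, by simpa using evalWord_encode_append φ [],
      (satisfiable_iff_truthSet_nonempty φ).1 hφ⟩
  · rintro ⟨v, hw, hv⟩
    obtain ⟨l, rfl, hl⟩ := exists_formulas_of_evalWord w (by simp [hw])
    rw [hw] at hl
    rcases l with _ | ⟨φ, _ | ⟨ψ, l⟩⟩ <;> simp at hl
    exact ⟨φ, (satisfiable_iff_truthSet_nonempty φ).2 (hl ▸ hv), by simp⟩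

theorem length_evalWord_le (w : List (Symbol Atm Val)) : (evalWord w).length ≤ w.length := by
  induction w with
  | nil => rfl
  | cons c w ih =>
    simp only [evalWord_cons, Symbol.reduce, List.length_cons, List.length_drop]
    omega

/-! ### The machine -/

namespace SatMachine

open Turing StateTransition

/-- The stacks: the input, the reversed input, the stack of truth sets, and the output. -/
inductive Stack
  | input
  | work
  | vals
  | out
  deriving DecidableEq

instance : Fintype Stack := ⟨{.input, .work, .vals, .out}, fun k => by cases k <;> simp⟩

/-- The alphabets of the stacks. -/
abbrev Alph (Atm Val : Type) : Stack → Type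
  | .input | .work => Symbol Atm Val
  | .vals => StackVal Atm Val
  | .out => Bool

/-- The labels: reversing the input, evaluating, writing the answer, clearing the stack. -/
inductive Label
  | scan
  | eval
  | answer
  | clear
  deriving DecidableEq

instance : Fintype Label :=
  ⟨{.scan, .eval, .answer, .clear}, fun l => by cases l <;> simp⟩

/-- The internal states: a register for a symbol and two for stack entries. -/
structure Reg (Atm Val : Type) where
  sym : Option (Symbol Atm Val)
  fst : Option (StackVal Atm Val)
  snd : Option (StackVal Atm Val)

/-- The initial internal state. -/
def Reg.empty : Reg Atm Val := ⟨none, none, none⟩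

instance [Finite Atm] [Finite Val] : Finite (Reg Atm Val) :=
  Finite.of_injective (fun r => (r.sym, r.fst, r.snd)) <| by
    rintro ⟨a, b, c⟩ ⟨a', b', c'⟩ h
    cases h
    rfl

theorem finite_alph [Finite Atm] [Finite Val] (k : Stack) : Finite (Alph Atm Val k) := by
  cases k <;> dsimp only [Alph] <;> infer_instance

open scoped Classical in
/-- The answer for the two topmost entries of the final stack. -/
noncomputable def Reg.accepts (r : Reg Atm Val) : Bool :=
  decide (r.snd = none ∧ ∃ v : Set (PointedMCM Atm Val), r.fst = some (some v) ∧ v.Nonempty)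

/-- Whether the symbol in the register has at least `n` arguments. -/
def Reg.needs (n : ℕ) (r : Reg Atm Val) : Bool := r.sym.any fun c => n ≤ c.arity

/-- The value of the symbol in the register at the entries in the registers. -/
def Reg.value (r : Reg Atm Val) : StackVal Atm Val :=
  r.sym.bind fun c => c.apply r.fst.join r.snd.join

/-- Statements of the machine. -/
abbrev Stmt (Atm Val : Type) : Type := TM2.Stmt (Alph Atm Val) Label (Reg Atm Val)

open TM2.Stmt in
/-- Push the value of the symbol in the register and continue the evaluation. -/
def pushValue : Stmt Atm Val :=
  push .vals Reg.value (goto fun _ => .eval)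

open TM2.Stmt in
/-- The program. -/
noncomputable def program : Label → Stmt Atm Val
  | .scan =>
    pop .input (fun _ c => ⟨c, none, none⟩) <|
      branch (fun r => r.sym.isSome)
        (push .work (fun r => r.sym.getD .neg) (goto fun _ => .scan))
        (goto fun _ => .eval)
  | .eval =>
    pop .work (fun _ c => ⟨c, none, none⟩) <|
      branch (fun r => r.sym.isSome)
        (branch (Reg.needs 1)
          (pop .vals (fun r a => ⟨r.sym, a, none⟩) <|
            branch (Reg.needs 2)
              (pop .vals (fun r b => ⟨r.sym, r.fst, b⟩) pushValue)
              pushValue)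
          pushValue)
        (goto fun _ => .answer)
  | .answer =>
    pop .vals (fun _ a => ⟨none, a, none⟩) <|
      pop .vals (fun r b => ⟨none, r.fst, b⟩) <|
        push .out Reg.accepts (goto fun _ => .clear)
  | .clear =>
    pop .vals (fun _ a => ⟨none, a, none⟩) <|
      branch (fun r => r.fst.isSome)
        (goto fun _ => .clear)
        (load (fun _ => Reg.empty) halt)

/-- The bundled machine. -/
noncomputable def machine (Atm Val : Type) [Finite Atm] [Finite Val] : FinTM2 :=
  letI : Fintype (Reg Atm Val) := Fintype.ofFinite _
  letI : Fintype (Alph Atm Val .input) := @Fintype.ofFinite _ (finite_alph _)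
  { K := Stack
    k₀ := .input
    k₁ := .out
    Γ := Alph Atm Val
    Λ := Label
    main := .scan
    σ := Reg Atm Val
    initialState := Reg.empty
    m := program }

/-- The stack contents with the given lists. -/
def contents (i w : List (Symbol Atm Val)) (v : List (StackVal Atm Val)) (o : List Bool) :
    ∀ k, List (Alph Atm Val k)
  | .input => i
  | .work => w
  | .vals => v
  | .out => o

section contents

variable (i w : List (Symbol Atm Val)) (v : List (StackVal Atm Val)) (o : List Bool)

theorem update_input (i' : List (Symbol Atm Val)) :
    Function.update (contents i w v o) .input i' = contents i' w v o := by
  funext k; cases k <;> simp [Function.update] <;> rfl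

theorem update_work (w' : List (Symbol Atm Val)) :
    Function.update (contents i w v o) .work w' = contents i w' v o := by
  funext k; cases k <;> simp [Function.update] <;> rfl

theorem update_vals (v' : List (StackVal Atm Val)) :
    Function.update (contents i w v o) .vals v' = contents i w v' o := by
  funext k; cases k <;> simp [Function.update] <;> rfl

theorem update_out (o' : List (Bool)) :
    Function.update (contents i w v o) .out o' = contents i w v o' := by
  funext k; cases k <;> simp [Function.update] <;> rfl

variable (r : Reg Atm Val) (q : Stmt Atm Val)

@[simp high] theorem stepAux_pop_input (f : Reg Atm Val → Option (Symbol Atm Val) → Reg Atm Val) :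
    TM2.stepAux (.pop .input f q : Stmt Atm Val) r (contents i w v o) =
      TM2.stepAux q (f r i.head?) (contents i.tail w v o) :=
  congrArg (TM2.stepAux q _) (update_input i w v o _)

@[simp high] theorem stepAux_pop_work (f : Reg Atm Val → Option (Symbol Atm Val) → Reg Atm Val) :
    TM2.stepAux (.pop .work f q : Stmt Atm Val) r (contents i w v o) =
      TM2.stepAux q (f r w.head?) (contents i w.tail v o) :=
  congrArg (TM2.stepAux q _) (update_work i w v o _)

@[simp high] theorem stepAux_pop_vals (f : Reg Atm Val → Option (StackVal Atm Val) → Reg Atm Val) :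
    TM2.stepAux (.pop .vals f q : Stmt Atm Val) r (contents i w v o) =
      TM2.stepAux q (f r v.head?) (contents i w v.tail o) :=
  congrArg (TM2.stepAux q _) (update_vals i w v o _)

@[simp high] theorem stepAux_push_work (f : Reg Atm Val → Symbol Atm Val) :
    TM2.stepAux (.push .work f q : Stmt Atm Val) r (contents i w v o) =
      TM2.stepAux q r (contents i (f r :: w) v o) :=
  congrArg (TM2.stepAux q _) (update_work i w v o _)

@[simp high] theorem stepAux_push_vals (f : Reg Atm Val → StackVal Atm Val) :
    TM2.stepAux (.push .vals f q : Stmt Atm Val) r (contents i w v o) =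
      TM2.stepAux q r (contents i w (f r :: v) o) :=
  congrArg (TM2.stepAux q _) (update_vals i w v o _)

@[simp high] theorem stepAux_push_out (f : Reg Atm Val → Bool) :
    TM2.stepAux (.push .out f q : Stmt Atm Val) r (contents i w v o) =
      TM2.stepAux q r (contents i w v (f r :: o)) :=
  congrArg (TM2.stepAux q _) (update_out i w v o _)

end contents

/-- Configurations of the machine. -/
abbrev Cfg (Atm Val : Type) : Type := TM2.Cfg (Alph Atm Val) Label (Reg Atm Val)

/-- The machine gets from one configuration to another in at most `n` steps. -/
def Runs (a b : Cfg Atm Val) (n : ℕ) : Prop :=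
  Nonempty (EvalsToInTime (TM2.step program) a (some b) n)

theorem Runs.refl (a : Cfg Atm Val) : Runs a a 0 := ⟨EvalsToInTime.refl _ _⟩

theorem Runs.trans {a b c : Cfg Atm Val} {m n : ℕ} : Runs a b m → Runs b c n → Runs a c (n + m) :=
  fun ⟨h⟩ ⟨h'⟩ => ⟨EvalsToInTime.trans _ m n _ b _ h h'⟩

theorem Runs.step {a b c : Cfg Atm Val} {n : ℕ} (h : TM2.step program a = some b)
    (h' : Runs b c n) : Runs a c (n + 1) :=
  Runs.trans ⟨⟨⟨1, by simpa [flip] using h⟩, le_rfl⟩⟩ h'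

theorem runs_scan (i : List (Symbol Atm Val)) : ∀ (w : List (Symbol Atm Val)) (r : Reg Atm Val),
    Runs ⟨some .scan, r, contents i w [] []⟩
      ⟨some .eval, Reg.empty, contents [] (i.reverse ++ w) [] []⟩ (i.length + 1) := by
  induction i with
  | nil =>
    intro w r
    refine .step ?_ (.refl _)
    simp [program, Reg.empty]
  | cons c i ih =>
    intro w r
    refine .step ?_ (by simpa using ih (c :: w) ⟨some c, none, none⟩)
    simp [program]

theorem step_eval (c : Symbol Atm Val) (w : List (Symbol Atm Val)) (v : List (StackVal Atm Val))
    (r : Reg Atm Val) :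
    ∃ r', TM2.step program ⟨some .eval, r, contents [] (c :: w) v []⟩ =
      some ⟨some .eval, r', contents [] w (c.reduce v) []⟩ := by
  rcases c with p | x | _ | _ | _ | _ <;>
    simp [program, pushValue, Reg.needs, Symbol.arity, Reg.value, Symbol.reduce, Symbol.apply,
      ← List.drop_one]

theorem runs_eval (w : List (Symbol Atm Val)) :
    ∀ (v : List (StackVal Atm Val)) (r : Reg Atm Val),
    Runs ⟨some .eval, r, contents [] w v []⟩
      ⟨some .answer, Reg.empty, contents [] [] (w.foldl (fun v c => c.reduce v) v) []⟩
      (w.length + 1) := by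
  induction w with
  | nil =>
    intro v r
    refine .step ?_ (.refl _)
    simp [program, Reg.empty]
  | cons c w ih =>
    intro v r
    obtain ⟨r', h⟩ := step_eval c w v r
    exact .step h (ih _ r')

theorem runs_clear (v : List (StackVal Atm Val)) (o : List Bool) : ∀ r : Reg Atm Val,
    Runs ⟨some .clear, r, contents [] [] v o⟩
      ⟨none, Reg.empty, contents [] [] [] o⟩ (v.length + 1) := by
  induction v with
  | nil =>
    intro r
    refine .step ?_ (.refl _)
    simp [program]
  | cons a v ih =>
    intro r
    refine .step ?_ (ih ⟨none, some a, none⟩)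
    simp [program]

open scoped Classical in
/-- The machine decides the satisfiability problem. -/
theorem runs_main (i : List (Symbol Atm Val)) :
    Runs ⟨some .scan, Reg.empty, contents i [] [] []⟩
      ⟨none, Reg.empty, contents [] [] [] [decide (i ∈ satLanguage Atm Val)]⟩
      (3 * i.length + 4) := by
  have h₁ := runs_scan i [] Reg.empty
  have h₂ := runs_eval i.reverse [] Reg.empty
  have hf : i.reverse.foldl (fun v c => c.reduce v) [] = evalWord i := by
    rw [List.foldl_reverse]; rfl
  rw [hf, List.length_reverse] at h₂
  rw [List.append_nil] at h₁
  have hacc : Reg.accepts ⟨none, (evalWord i).head?, (evalWord i).tail.head?⟩ =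
      decide (i ∈ satLanguage Atm Val) := by
    rw [Reg.accepts, decide_eq_decide, mem_satLanguage_iff_evalWord]
    rcases evalWord i with _ | ⟨a, _ | ⟨b, l⟩⟩ <;> simp
  have h₃ := runs_clear (evalWord i).tail.tail [decide (i ∈ satLanguage Atm Val)]
    ⟨none, (evalWord i).head?, (evalWord i).tail.head?⟩
  have h₄ := (h₁.trans h₂).trans (.step (by simp [program, ← hacc]) h₃)
  obtain ⟨h₄⟩ := h₄
  refine ⟨⟨h₄.toEvalsTo, h₄.steps_le_m.trans ?_⟩⟩
  have := length_evalWord_le i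
  simp only [List.length_tail]
  omega

theorem initList_machine [Finite Atm] [Finite Val] (i : List (Symbol Atm Val)) :
    initList (machine Atm Val) i = (⟨some .scan, Reg.empty, contents i [] [] []⟩ : Cfg Atm Val) := by
  refine congrArg (TM2.Cfg.mk _ _) (funext fun k => ?_)
  cases k <;> rfl

theorem haltList_machine [Finite Atm] [Finite Val] (o : List Bool) :
    haltList (machine Atm Val) o = (⟨none, Reg.empty, contents [] [] [] o⟩ : Cfg Atm Val) := by
  refine congrArg (TM2.Cfg.mk _ _) (funext fun k => ?_)
  cases k <;> rfl

end SatMachine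

open SatMachine in
open scoped Classical in
theorem decidableInPolyTime_satLanguage (Atm Val : Type) [Finite Atm] [Finite Val] :
    DecidableInPolyTime (satLanguage Atm Val) := by
  refine ⟨fun w => decide (w ∈ satLanguage Atm Val), fun w => by simp, ?_⟩
  refine ⟨{ tm := machine Atm Val
            inputAlphabet := Equiv.refl (Symbol Atm Val)
            outputAlphabet := Equiv.refl Bool
            time := 3 * Polynomial.X + 4
            outputsFun := fun w => ?_ },
    finite_alph⟩
  have key : ∀ i : List (Symbol Atm Val), i = w →
      Turing.TM2OutputsInTime (machine Atm Val) i (some [decide (w ∈ satLanguage Atm Val)])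
        (3 * w.length + 4) := by
    rintro i rfl
    have h := (runs_main i).some
    rwa [← initList_machine, ← haltList_machine] at h
  have e : Polynomial.eval w.length (3 * Polynomial.X + 4 : Polynomial ℕ) = 3 * w.length + 4 := by
    simp
  change Turing.TM2OutputsInTime _ _ _ (Polynomial.eval w.length _)
  rw [e]
  exact key _ (List.map_id w)

end PLC

/-- For a finite set of atomic propositions (and a finite set of output values), satisfiability of
formulas relative to the class of multi-classifier models is decidable in polynomial time. -/
theorem mainTheorem4 (Atm Val : Type) [Finite Atm] [Finite Val] :
    PLC.DecidableInPolyTime (PLC.satLanguage Atm Val) := by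
  exact PLC.decidableInPolyTime_satLanguage Atm Val
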